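/- Let $m\ge 0$ and let $S_m$ be the star graph with one central vertex $v_0$ and $m$ external vertices $v_1,\dots,v_m$, in which $v_i$ is joined to $v_0$ by one edge $e_i$ for each $i=1,\dots,m$. Let $(\mathcal G,S_m)$ be a graph of groups in which the group of $v_0$ is a free group of finite rank, the group of each external vertex $v_i$ is a free abelian group of finite rank, and the group of each edge $e_i$ is cyclic with generator $k_i$. Let $\alpha_{e_i}$ and $\omega_{e_i}$ be the monomorphisms of the edge group of $e_i$ into the central and the external vertex group, respectively. Assume that for every $i$ the element $\omega_{e_i}(k_i)$ is primitive, that is, it belongs to some basis of the free abelian group of $v_i$. Then the fundamental group $\pi_1(\mathcal G,S_m)$ is $\mathbb Z$-linear: for some $n$ there is an injective homomorphism $\pi_1(\mathcal G,S_m)\to GL_n(\mathbb Z)$. Here $\pi_1(\mathcal G,S_m)$ is the quotient of the free product of all the vertex groups and the free group on letters $t_e$, one for each oriented edge $e$ of $S_m$, by the relations $t_e\,\alpha_e(g)\,t_e^{-1}=\alpha_{\bar e}(g)$ for $g$ in the edge group $G_e=G_{\bar e}$ (where $\bar e$ is the inverse of $e$ and $\alpha_e$ is the monomorphism of $G_e$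 into the group of the initial vertex of $e$), $t_et_{\bar e}=1$, and $t_e=1$ for every edge $e$ of the maximal subtree (which for a star is the whole graph). -/

import Mathlib

universe u v w x

/-- A (multi)graph in the sense of Serre, with vertex set `V`. The type `E` indexes the pairs
`{e, ē}` of mutually inverse edges; the two edges of the pair `e` are `(e, false)` and `(e, true)`.
`start e b` is the initial vertex of the edge `(e, b)`. Loops and multiple edges are allowed. -/
structure SerreGraph (V : Type u) (E : Type v) where
  start : E → Bool → V

namespace SerreGraph

variable {V : Type u} {E : Type v}

/-- The inverse `ē` of an (oriented) edge. -/
def inv (d : E × Bool) : E × Bool := (d.1, !d.2)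

/-- The initial vertex `α(e)` of an edge. -/
def initial (Γ : SerreGraph V E) (d : E × Bool) : V := Γ.start d.1 d.2

/-- The terminal vertex `ω(e) = α(ē)` of an edge. -/
def terminal (Γ : SerreGraph V E) (d : E × Bool) : V := Γ.initial (inv d)

/-- `Γ.IsPath p l q`: the list of edges `l` is a path from `p` to `q`. -/
def IsPath (Γ : SerreGraph V E) : V → List (E × Bool) → V → Prop
  | p, [], q => p = q
  | p, d :: l, q => Γ.initial d = p ∧ IsPath Γ (Γ.terminal d) l q

/-- A path is reduced if it contains no consecutive pair `e ē`. -/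
def IsReducedPath (l : List (E × Bool)) : Prop :=
  l.IsChain (fun d d' => d' ≠ inv d)

/-- The graph is nonempty and any two of its vertices are joined by a path. -/
def Connected (Γ : SerreGraph V E) : Prop :=
  Nonempty V ∧ ∀ p q : V, ∃ l, Γ.IsPath p l q

/-- The set `T` of edge pairs, together with all the vertices, forms a maximal subtree of `Γ`:
any two vertices are joined by a path with edges in `T`, and every reduced closed path with
edges in `T` is trivial. -/
def IsMaximalSubtree (Γ : SerreGraph V E) (T : Set E) : Prop :=
  (∀ p q : V, ∃ l, Γ.IsPath p l q ∧ ∀ d ∈ l, d.1 ∈ T) ∧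
  (∀ (p : V) (l : List (E × Bool)),
    Γ.IsPath p l p → (∀ d ∈ l, d.1 ∈ T) → IsReducedPath l → l = [])

/-- The star graph `S_m`: a central vertex `none`, external vertices `some i` for `i : Fin m`, and
for each `i` one pair of mutually inverse edges, `(i, false)` going from the central vertex to
`some i` and `(i, true)` going from `some i` to the central vertex. -/
def starGraph (m : ℕ) : SerreGraph (Option (Fin m)) (Fin m) where
  start i b := bif b then some i else none

end SerreGraph

/-- A graph of groups over the graph `Γ`. Both edges of a pair `e` carry the same edge group
`edgeGroup e`, and `incl e b` is the monomorphism of this group into the group of the initial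
vertex of the edge `(e, b)`. -/
structure GraphOfGroups {V : Type u} {E : Type v} (Γ : SerreGraph V E) where
  connected : Γ.Connected
  vertexGroup : V → Type w
  [vertexGroupInst : ∀ p, Group (vertexGroup p)]
  edgeGroup : E → Type x
  [edgeGroupInst : ∀ e, Group (edgeGroup e)]
  incl : ∀ (e : E) (b : Bool), edgeGroup e →* vertexGroup (Γ.start e b)
  incl_injective : ∀ (e : E) (b : Bool), Function.Injective (incl e b)

namespace GraphOfGroups

attribute [instance] vertexGroupInst edgeGroupInst

variable {V : Type u} {E : Type v} {Γ : SerreGraph V E}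

/-- The free product of all vertex groups and the free group with basis `t_e`, `e` running over
all (oriented) edges. -/
abbrev FreeProd (𝒢 : GraphOfGroups.{u, v, w, x} Γ) : Type (max u v w) :=
  Monoid.Coprod (Monoid.CoprodI 𝒢.vertexGroup) (FreeGroup (E × Bool))

/-- An element of a vertex group, in the free product. -/
def vert (𝒢 : GraphOfGroups.{u, v, w, x} Γ) (p : V) (g : 𝒢.vertexGroup p) : 𝒢.FreeProd :=
  Monoid.Coprod.inl (Monoid.CoprodI.of g)

/-- The letter `t_(e, b)` of the oriented edge `(e, b)`, in the free product. -/
def letter (𝒢 : GraphOfGroups.{u, v, w, x} Γ) (e : E) (b : Bool) : 𝒢.FreeProd :=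
  Monoid.Coprod.inr (FreeGroup.of (e, b))

/-- The relators `t_e α_e(g) t_e⁻¹ (α_ē(g))⁻¹` and `t_e t_ē` of the path group. -/
def pathRelators (𝒢 : GraphOfGroups.{u, v, w, x} Γ) : Set 𝒢.FreeProd :=
  {r | ∃ (e : E) (b : Bool) (g : 𝒢.edgeGroup e),
      r = 𝒢.letter e b * 𝒢.vert _ (𝒢.incl e b g) * (𝒢.letter e b)⁻¹ *
        (𝒢.vert _ (𝒢.incl e (!b) g))⁻¹} ∪
  {r | ∃ (e : E) (b : Bool), r = 𝒢.letter e b * 𝒢.letter e (!b)}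

/-- The path group `F(𝒢, Γ)`. -/
abbrev PathGroup (𝒢 : GraphOfGroups.{u, v, w, x} Γ) : Type (max u v w) :=
  𝒢.FreeProd ⧸ Subgroup.normalClosure 𝒢.pathRelators

/-- The fundamental group `π₁(𝒢, Γ, T)` with respect to a maximal subtree `T`: the quotient of the
path group by the normal closure of the set of letters `t_e` with `e` an edge of `T`. -/
abbrev FundamentalGroup (𝒢 : GraphOfGroups.{u, v, w, x} Γ) (T : Set E) : Type (max u v w) :=
  𝒢.PathGroup ⧸ Subgroup.normalClosure
    {t : 𝒢.PathGroup | ∃ e ∈ T, ∃ b : Bool, t = QuotientGroup.mk (𝒢.letter e b)}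

end GraphOfGroups

/-- `G` is a free group of finite rank. -/
def IsFreeOfFiniteRank (G : Type u) [Group G] : Prop :=
  ∃ n : ℕ, Nonempty (G ≃* FreeGroup (Fin n))

/-- `G` is a free abelian group of finite rank (written multiplicatively). -/
def IsFreeAbelianOfFiniteRank (G : Type u) [Group G] : Prop :=
  ∃ n : ℕ, Nonempty (G ≃* Multiplicative (Fin n → ℤ))

/-- An element of a free abelian group of finite rank is primitive if it belongs to some basis.
A basis with `n` elements is the same as an isomorphism with `ℤⁿ`, the basis elements
corresponding to the standard unit vectors. -/
def IsPrimitiveElement {G : Type u} [Group G] (g : G) : Prop :=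
  ∃ (n : ℕ) (φ : G ≃* Multiplicative (Fin n → ℤ)) (j : Fin n),
    φ g = Multiplicative.ofAdd (Pi.single j 1)

/-- `G` is `ℤ`-linear: it has a faithful representation into `GL_n(ℤ)` for some `n`. -/
def IsZLinear (G : Type u) [Group G] : Prop :=
  ∃ (n : ℕ) (ρ : G →* Matrix.GeneralLinearGroup (Fin n) ℤ), Function.Injective ρ

/-! Since the edge generator is primitive in each external group, that group splits as ⟨w_i⟩ × A_i.
The fundamental group is therefore a free group F with the A_i adjoined subject to [u_i, A_i] = 1,
where u_i ≠ 1 is the image of the edge generator in F.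

Up to conjugation u_i is a cyclically reduced word. Conjugating A_i by the prefixes of this word
gives one torus for each position j in a finite set J, and [u_i, A_i] = 1 becomes: each letter
conjugates the torus at one position to the torus at a neighbouring one. By cyclic reducedness each
basis element s acts as a partial injection of J, which extends to a permutation τ_s. Over the
Schreier graph of these permutations the relations only say that certain edges and tori commute, as
in a right-angled Artin group. Integral unipotent maps with these commutations (`blockMap`), induced
up to functions on `Perm J`, give the representation.

Faithfulness (`injective_of_partial_action`) is ping-pong along a word of minimal length: its last
applied syllable leaves a visible displacement, because whatever could undo it would shorten the
word. `isZLinear_of_star` passes between the two presentations. -/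

/-! ### A system of commuting and interacting unipotent transformations -/

section Transvections

variable {N C : Type*} [Fintype C]

/-- The unipotent transformation attached to the block `g` and the vector `a`. The block `g` has a
level `(m g).1` and a displacement `(m g).2`; the displacement is changed by `a` times the level,
and the levels of all the blocks interacting with `g` are increased quadratically. -/
def blockMap [DecidableEq N] (I : N → N → Prop) [DecidableRel I] (g : N)
    (a : C → ℤ) : (N → ℤ × (C → ℤ)) →ₗ[ℤ] (N → ℤ × (C → ℤ)) where
  toFun m h := ((m h).1 + if I g h then 8 * ∑ c, (a c ^ 2 * (m g).1 + 2 * a c * (m g).2 c) else 0,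
    (m h).2 + if h = g then (m g).1 • a else 0)
  map_add' m m' := by
    funext h
    refine Prod.ext ?_ ?_
    · by_cases hh : I g h
      · simp only [Pi.add_apply, Prod.fst_add, Prod.snd_add, if_pos hh]
        rw [add_add_add_comm, ← mul_add, ← Finset.sum_add_distrib]
        congr 2
        exact Finset.sum_congr rfl fun c _ => by ring
      · simp [hh]
    · by_cases hh : h = g
      · simp only [Pi.add_apply, Prod.fst_add, Prod.snd_add, if_pos hh, add_smul]
        abel
      · simp [hh]
  map_smul' r m := by
    funext h
    refine Prod.ext ?_ ?_
    · by_cases hh : I g h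
      · simp only [Pi.smul_apply, Prod.smul_fst, Prod.smul_snd, if_pos hh, smul_eq_mul,
          RingHom.id_apply, mul_add, Finset.mul_sum]
        congr 1
        exact Finset.sum_congr rfl fun c _ => by ring
      · simp [hh]
    · by_cases hh : h = g
      · simp only [Pi.smul_apply, Prod.smul_fst, Prod.smul_snd, if_pos hh, smul_add, smul_smul,
          RingHom.id_apply, smul_eq_mul]
      · simp [hh]

variable [DecidableEq N] (I : N → N → Prop) [DecidableRel I]

theorem blockMap_apply (g : N) (a : C → ℤ) (m : N → ℤ × (C → ℤ)) (h : N) :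
    blockMap I g a m h = ((m h).1 +
      if I g h then 8 * ∑ c, (a c ^ 2 * (m g).1 + 2 * a c * (m g).2 c) else 0,
      (m h).2 + if h = g then (m g).1 • a else 0) := rfl

theorem blockMap_zero (g : N) : blockMap (C := C) I g 0 = LinearMap.id := by
  refine LinearMap.ext fun m => funext fun h => ?_
  simp [blockMap_apply]

/-- With level d and displacement x of `g`, the added level is 8 ∑ ((x + da)² − x²)/d. Such
differences telescope, and d stays fixed because `g` does not interact with itself. -/
theorem blockMap_add (hI : ∀ g, ¬ I g g) (g : N) (a b : C → ℤ) :
    blockMap I g (a + b) = blockMap I g a ∘ₗ blockMap I g b := by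
  refine LinearMap.ext fun m => funext fun h => ?_
  simp only [LinearMap.comp_apply, blockMap_apply, if_neg (hI g), add_zero, if_pos]
  refine Prod.ext ?_ ?_
  · by_cases hh : I g h
    · simp only [if_pos hh]
      rw [add_assoc, ← mul_add, ← Finset.sum_add_distrib]
      congr 2
      exact Finset.sum_congr rfl fun c _ => by
        simp only [Pi.add_apply, Pi.smul_apply, smul_eq_mul]; ring
    · simp [hh]
  · by_cases hh : h = g
    · simp only [if_pos hh, smul_add]; abel
    · simp [hh]

/-- Each map reads only its own block, which the other leaves unchanged. -/
theorem blockMap_comm {g g' : N} (hne : g ≠ g') (h₁ : ¬ I g g') (h₂ : ¬ I g' g) (a b : C → ℤ) :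
    blockMap I g a ∘ₗ blockMap I g' b = blockMap I g' b ∘ₗ blockMap I g a := by
  refine LinearMap.ext fun m => funext fun h => ?_
  simp only [LinearMap.comp_apply, blockMap_apply, if_neg h₁, if_neg h₂, if_neg hne,
    if_neg hne.symm, add_zero]
  refine Prod.ext ?_ ?_
  · simp only; ring
  · simp only; abel

/-- `blockMap` as a homomorphism from vectors to automorphisms. -/
def blockAut (hI : ∀ g, ¬ I g g) (g : N) :
    Multiplicative (C → ℤ) →* ((N → ℤ × (C → ℤ)) ≃ₗ[ℤ] (N → ℤ × (C → ℤ))) where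
  toFun a := LinearEquiv.ofLinearMap (blockMap I g a.toAdd) (blockMap I g (-a.toAdd))
    (by rw [← blockMap_add I hI, add_neg_cancel, blockMap_zero])
    (by rw [← blockMap_add I hI, neg_add_cancel, blockMap_zero])
  map_one' := LinearEquiv.toLinearMap_injective (blockMap_zero I g)
  map_mul' a b := LinearEquiv.toLinearMap_injective (blockMap_add I hI g a.toAdd b.toAdd)

end Transvections

/-! ### Ping-pong -/

section PingPong

variable {N C : Type*}

/-- Positivity of the levels, together with the condition that of two interacting blocks at least
one is dominated by its level. -/
structure IsPositiveState (I : N → N → Prop) (m : N → ℤ × (C → ℤ)) : Prop where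
  pos : ∀ g, 0 < (m g).1
  pair : ∀ g h, I g h → ∀ c c', 0 < ((m g).1 - 4 * |(m g).2 c|) + ((m h).1 - 4 * |(m h).2 c'|)

/-- All displacements of the block `g` are small compared with the level of `g`. -/
def IsNeutral (m : N → ℤ × (C → ℤ)) (g : N) : Prop := ∀ c, 4 * |(m g).2 c| < (m g).1

/-- No displacement of the block `g` is large in a direction opposite to that of `a`. -/
def IsCompatible (m : N → ℤ × (C → ℤ)) (g : N) (a : C → ℤ) : Prop :=
  ∀ c, a c ≠ 0 → 0 < |a c| * (m g).1 + 4 * (a c * (m g).2 c)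

theorem IsNeutral.isCompatible {m : N → ℤ × (C → ℤ)} {g : N} (h : IsNeutral m g) (a : C → ℤ) :
    IsCompatible m g a := by
  intro c hc
  have h1 := h c
  have h2 : 0 < |a c| := abs_pos.2 hc
  have h3 : -(|a c| * |(m g).2 c|) ≤ a c * (m g).2 c := by
    rw [← abs_mul]; exact neg_abs_le _
  nlinarith

/-- Compatibility limits the loss from the mixed term to 4|a|d, while the square term gives 8a²d ≥
8|a|d. -/
theorem IsCompatible.term_bound {m : N → ℤ × (C → ℤ)} {g : N} {a : C → ℤ}
    (ha : IsCompatible m g a) {c : C} (hc : a c ≠ 0) (hd : 0 < (m g).1) :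
    4 * |a c| * (m g).1 < 8 * (a c ^ 2 * (m g).1 + 2 * a c * (m g).2 c) := by
  have h1 := ha c hc
  have h2 : 1 ≤ |a c| := Int.one_le_abs hc
  have h3 : a c ^ 2 = |a c| ^ 2 := (sq_abs _).symm
  rw [h3]
  nlinarith [mul_nonneg (mul_nonneg (sub_nonneg.2 h2) (abs_nonneg (a c))) hd.le]

theorem IsCompatible.term_nonneg {m : N → ℤ × (C → ℤ)} {g : N} {a : C → ℤ}
    (ha : IsCompatible m g a) (hd : 0 < (m g).1) (c : C) :
    0 ≤ a c ^ 2 * (m g).1 + 2 * a c * (m g).2 c := by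
  by_cases hc : a c = 0
  · rw [hc]; simp
  · have h1 := ha.term_bound hc hd
    have : 0 ≤ 4 * |a c| * (m g).1 := by positivity
    linarith

variable [Fintype C]

theorem IsCompatible.le_sum {m : N → ℤ × (C → ℤ)} {g : N} {a : C → ℤ}
    (ha : IsCompatible m g a) (hd : 0 < (m g).1) (c : C) :
    8 * (a c ^ 2 * (m g).1 + 2 * a c * (m g).2 c) ≤
      8 * ∑ c, (a c ^ 2 * (m g).1 + 2 * a c * (m g).2 c) := by
  have := Finset.single_le_sum (f := fun c => a c ^ 2 * (m g).1 + 2 * a c * (m g).2 c)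
    (fun c _ => ha.term_nonneg hd c) (Finset.mem_univ c)
  linarith

variable [DecidableEq N] (I : N → N → Prop) [DecidableRel I]

theorem blockMap_of_not_interacting {g h : N} (hne : h ≠ g) (hh : ¬ I g h) (a : C → ℤ)
    (m : N → ℤ × (C → ℤ)) : blockMap I g a m h = m h := by
  simp [blockMap_apply, hne, hh]

theorem blockMap_self (hI : ∀ g, ¬ I g g) (g : N) (a : C → ℤ) (m : N → ℤ × (C → ℤ)) :
    blockMap I g a m g = ((m g).1, (m g).2 + (m g).1 • a) := by
  simp [blockMap_apply, hI]

theorem blockMap_interacting (hI : ∀ g, ¬ I g g) {g h : N} (hh : I g h) (a : C → ℤ) (m : N → ℤ × (C → ℤ)) :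
    blockMap I g a m h =
      ((m h).1 + 8 * ∑ c, (a c ^ 2 * (m g).1 + 2 * a c * (m g).2 c), (m h).2) := by
  have hne : h ≠ g := by rintro rfl; exact hI _ hh
  simp [blockMap_apply, hne, hh]

/-- The level of `h` grows by more than four times the level of `g`, whereas `pair` bounds the
excess of 4|displacement| over level at `h` by the level of `g`. -/
theorem IsPositiveState.isNeutral_blockMap (hI : ∀ g, ¬ I g g) {m : N → ℤ × (C → ℤ)} (hm : IsPositiveState I m)
    {g : N} {a : C → ℤ} (ha : IsCompatible m g a) (ha0 : a ≠ 0) {h : N} (hh : I g h) :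
    IsNeutral (blockMap I g a m) h := by
  obtain ⟨c, hc⟩ := Function.ne_iff.1 ha0
  intro c'
  rw [blockMap_interacting I hI hh]
  have h1 := hm.pair g h hh c c'
  have h2 := ha.le_sum (hm.pos g) c
  have h3 := ha.term_bound hc (hm.pos g)
  have h4 : 1 ≤ |a c| := Int.one_le_abs hc
  have h5 := hm.pos g
  have h6 := abs_nonneg ((m g).2 c)
  simp only
  nlinarith

/-- The factor 8 in `blockMap` is chosen for `pair`: 4|displacement| at `g` grows by at most 4|a|d,
and the level of each interacting block by more than that. -/
theorem IsPositiveState.blockMap (hI : ∀ g, ¬ I g g) {m : N → ℤ × (C → ℤ)} (hsymm : ∀ g h, I g h → I h g)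
    (hm : IsPositiveState I m) {g : N} {a : C → ℤ} (ha : IsCompatible m g a) :
    IsPositiveState I (blockMap I g a m) := by
  have hS : 0 ≤ 8 * ∑ c, (a c ^ 2 * (m g).1 + 2 * a c * (m g).2 c) :=
    mul_nonneg (by norm_num) (Finset.sum_nonneg fun c _ => ha.term_nonneg (hm.pos g) c)
  have hself : ∀ h, I g h → ∀ c c', 0 < ((_root_.blockMap I g a m g).1 -
      4 * |(_root_.blockMap I g a m g).2 c|) + ((_root_.blockMap I g a m h).1 -
      4 * |(_root_.blockMap I g a m h).2 c'|) := by
    intro h hh c c'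
    rw [blockMap_self I hI, blockMap_interacting I hI hh]
    have h1 := hm.pair g h hh c c'
    have h5 := hm.pos g
    simp only [Pi.add_apply, Pi.smul_apply, smul_eq_mul]
    by_cases hc : a c = 0
    · simp only [hc, mul_zero, add_zero]; linarith
    · have h2 := ha.le_sum h5 c
      have h3 := ha c hc
      have h4 : 1 ≤ |a c| := Int.one_le_abs hc
      have h6 : |(m g).2 c + (m g).1 * a c| ≤ |(m g).2 c| + (m g).1 * |a c| := by
        refine (abs_add_le _ _).trans ?_
        rw [abs_mul, abs_of_pos h5]
      have h7 : a c ^ 2 = |a c| ^ 2 := (sq_abs _).symm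
      rw [h7] at h2
      nlinarith [mul_nonneg (mul_nonneg (sub_nonneg.2 h4) (abs_nonneg (a c))) h5.le]
  have hfst : ∀ h, (m h).1 ≤ (_root_.blockMap I g a m h).1 := by
    intro h
    rw [blockMap_apply]
    by_cases hh : I g h
    · simpa [hh] using hS
    · simp [hh]
  have hsnd : ∀ h, h ≠ g → (_root_.blockMap I g a m h).2 = (m h).2 := by
    intro h hh
    simp [blockMap_apply, hh]
  refine ⟨fun h => (hm.pos h).trans_le (hfst h), fun h h' hh c c' => ?_⟩
  by_cases h1 : h = g
  · subst h1; exact hself h' hh c c'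
  by_cases h2 : h' = g
  · subst h2
    have := hself h (hsymm _ _ hh) c' c
    linarith
  rw [hsnd h h1, hsnd h' h2]
  have := hm.pair h h' hh c c'
  linarith [hfst h, hfst h']

theorem IsCompatible.blockMap_self (hI : ∀ g, ¬ I g g) {m : N → ℤ × (C → ℤ)} {g : N} {a : C → ℤ}
    (ha : IsCompatible m g a) (hd : 0 < (m g).1) : IsCompatible (blockMap I g a m) g a := by
  intro c hc
  rw [_root_.blockMap_self I hI]
  have h1 := ha c hc
  simp only [Pi.add_apply, Pi.smul_apply, smul_eq_mul]
  nlinarith [mul_nonneg hd.le (sq_nonneg (a c))]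

/-- Before the move the displacement opposes `a` by less than d/4, and the move adds at least d in
the direction of `a`. -/
theorem IsCompatible.not_isNeutral (hI : ∀ g, ¬ I g g) {m : N → ℤ × (C → ℤ)} {g : N} {a : C → ℤ}
    (ha : IsCompatible m g a) (hd : 0 < (m g).1) (ha0 : a ≠ 0) :
    ¬ IsNeutral (blockMap I g a m) g := by
  obtain ⟨c, hc⟩ := Function.ne_iff.1 ha0
  intro hn
  have h1 := hn c
  rw [_root_.blockMap_self I hI] at h1
  have h2 := ha c hc
  have h4 : 1 ≤ |a c| := Int.one_le_abs hc
  simp only [Pi.add_apply, Pi.smul_apply, smul_eq_mul] at h1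
  have h5 : a c * ((m g).2 c + (m g).1 * a c) ≤ |a c| * |(m g).2 c + (m g).1 * a c| := by
    rw [← abs_mul]; exact le_abs_self _
  have h6 : a c ^ 2 = |a c| ^ 2 := (sq_abs _).symm
  have h7 : a c * ((m g).2 c + (m g).1 * a c) = a c * (m g).2 c + |a c| ^ 2 * (m g).1 := by
    rw [← h6]; ring
  nlinarith [mul_nonneg (mul_nonneg (sub_nonneg.2 h4) (abs_nonneg (a c))) hd.le,
    mul_lt_mul_of_pos_left h1 (zero_lt_one.trans_le h4)]

end PingPong

/-! ### The representation -/

section Representation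

open Equiv (Perm)

/-- The blocks of the representation: one for every edge `(v, s)` of the Schreier graph of the
action of a free group on the permutations of `J`, and one for every element of `J`. -/
inductive Block (n : ℕ) (J : Type*)
  | edge (v : Perm J) (s : Fin n)
  | torus (O : J)

variable {n : ℕ} {J : Type*}

/-- Different blocks interact unless one is an edge and the other a torus along it. -/
def Block.Interacts (D : Fin n → Set J) : Block n J → Block n J → Prop
  | .edge v s, .edge v' s' => ¬ (v = v' ∧ s = s')
  | .edge v s, .torus O => v⁻¹ O ∉ D s
  | .torus O, .edge v s => v⁻¹ O ∉ D s
  | .torus O, .torus O' => O ≠ O'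

theorem Block.not_interacts_self (D : Fin n → Set J) (g : Block n J) : ¬ g.Interacts D g := by
  cases g <;> simp [Block.Interacts]

theorem Block.Interacts.symm (D : Fin n → Set J) (g h : Block n J) :
    g.Interacts D h → h.Interacts D g := by
  cases g <;> cases h <;> simp only [Block.Interacts, ne_eq] <;> grind

noncomputable instance : DecidableEq (Block n J) := Classical.decEq _

noncomputable instance (D : Fin n → Set J) : DecidableRel (Block.Interacts D) :=
  Classical.decRel _

theorem isCompatible_congr {N C : Type*} {m m' : N → ℤ × (C → ℤ)} {h : N} (e : m h = m' h)
    (a : C → ℤ) : IsCompatible m h a ↔ IsCompatible m' h a := by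
  simp only [IsCompatible, e]

theorem isNeutral_congr {N C : Type*} {m m' : N → ℤ × (C → ℤ)} {h : N} (e : m h = m' h) :
    IsNeutral m h ↔ IsNeutral m' h := by
  simp only [IsNeutral, e]

/-! ### Word length in letters and torus elements -/

variable {C : Type*}

variable {G : Type*} [Group G]

/-- `HasLength t b P k g`: the element `g` is a product of `k` factors, each of which is some
`t s`, its inverse, or some `b j a` with `a ∈ P j`. -/
inductive HasLength (t : Fin n → G) (b : J → Multiplicative (C → ℤ) →* G)
    (P : J → Subgroup (Multiplicative (C → ℤ))) : ℕ → G → Prop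
  | one : HasLength t b P 0 1
  | basis {k g} (s : Fin n) : HasLength t b P k g → HasLength t b P (k + 1) (t s * g)
  | basis_inv {k g} (s : Fin n) : HasLength t b P k g → HasLength t b P (k + 1) ((t s)⁻¹ * g)
  | torus {k g} (j : J) {a} : a ∈ P j → HasLength t b P k g → HasLength t b P (k + 1) (b j a * g)

theorem exists_hasLength {t : Fin n → G} {b : J → Multiplicative (C → ℤ) →* G}
    {P : J → Subgroup (Multiplicative (C → ℤ))}
    (hgen : Subgroup.closure (Set.range t ∪ {x | ∃ j, ∃ a ∈ P j, b j a = x}) = ⊤) (g : G) :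
    ∃ k, HasLength t b P k g := by
  have hg : g ∈ Subgroup.closure (Set.range t ∪ {x | ∃ j, ∃ a ∈ P j, b j a = x}) := by
    rw [hgen]; trivial
  induction hg using Subgroup.closure_induction_left with
  | one => exact ⟨0, .one⟩
  | mul_left x hx y _ ih =>
    obtain ⟨k, hk⟩ := ih
    rcases hx with ⟨s, rfl⟩ | ⟨j, a, ha, rfl⟩
    · exact ⟨_, hk.basis s⟩
    · exact ⟨_, hk.torus j ha⟩
  | inv_mul_cancel x hx y _ ih =>
    obtain ⟨k, hk⟩ := ih
    rcases hx with ⟨s, rfl⟩ | ⟨j, a, ha, rfl⟩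
    · exact ⟨_, hk.basis_inv s⟩
    · rw [← map_inv]
      exact ⟨_, hk.torus j (inv_mem ha)⟩

/-! ### The induced module and the automorphisms acting on it -/

variable [Fintype C]

/-- The module of the representation. -/
abbrev RepModule (n : ℕ) (J C : Type*) : Type _ := Perm J → Block n J → ℤ × (C → ℤ)

/-- The action of the torus with index `j`. -/
noncomputable def torusAut (D : Fin n → Set J) (j : J) :
    Multiplicative (C → ℤ) →* (RepModule n J C ≃ₗ[ℤ] RepModule n J C) where
  toFun a := LinearEquiv.piCongrRight fun v =>
    blockAut (Block.Interacts D) (Block.not_interacts_self D) (.torus (v j)) a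
  map_one' := by
    refine LinearEquiv.ext fun f => funext fun v => ?_
    simp
  map_mul' a b := by
    refine LinearEquiv.ext fun f => funext fun v => ?_
    simp

theorem torusAut_apply (D : Fin n → Set J) (j : J) (a : Multiplicative (C → ℤ)) (f : RepModule n J C) (v : Perm J) :
    torusAut D j a f v = blockMap (Block.Interacts D) (.torus (v j)) a.toAdd (f v) := rfl

variable [DecidableEq C] (c₀ : C)

/-- The automorphism by which the basis element `s` acts. -/
noncomputable def edgeAut (τ : Fin n → Perm J) (D : Fin n → Set J) (s : Fin n) :
    RepModule n J C ≃ₗ[ℤ] RepModule n J C :=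
  (LinearEquiv.piCongrRight fun v => blockAut (Block.Interacts D) (Block.not_interacts_self D)
    (.edge v s) (Multiplicative.ofAdd (Pi.single c₀ 1))) ≪≫ₗ
    LinearEquiv.funCongrLeft ℤ _ (Equiv.mulRight (τ s))

variable (τ : Fin n → Perm J) (D : Fin n → Set J)

theorem edgeAut_apply (s : Fin n) (f : RepModule n J C) (v : Perm J) :
    edgeAut c₀ τ D s f v =
      blockMap (Block.Interacts D) (.edge (v * τ s) s) (Pi.single c₀ 1) (f (v * τ s)) := rfl

theorem edgeAut_inv_apply (s : Fin n) (f : RepModule n J C) (v : Perm J) :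
    (edgeAut c₀ τ D s)⁻¹ f v =
      blockMap (Block.Interacts D) (.edge v s) (-Pi.single c₀ 1) (f (v * (τ s)⁻¹)) := rfl

/-- At every `v` the edge and torus blocks involved do not interact, exactly because `j ∈ D s`, so
`blockMap_comm` applies. -/
theorem edgeAut_conj_torusAut {s : Fin n} {j : J} (hj : j ∈ D s) (a : Multiplicative (C → ℤ)) :
    edgeAut c₀ τ D s * torusAut D j a * (edgeAut c₀ τ D s)⁻¹ = torusAut D (τ s j) a := by
  rw [mul_inv_eq_iff_eq_mul]
  refine LinearEquiv.ext fun f => funext fun v => ?_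
  have h : ¬ Block.Interacts D (.edge (v * τ s) s) (.torus (v (τ s j))) := by
    simp [Block.Interacts, hj]
  exact LinearMap.congr_fun (blockMap_comm (Block.Interacts D)
    (by simp : Block.edge (v * τ s) s ≠ .torus (v (τ s j))) h
    (fun h' => h (Block.Interacts.symm D _ _ h')) (Pi.single c₀ 1) a.toAdd) (f (v * τ s))

/-- What is known about the state `m` at `v` reached by an element `g` of minimal length `k`. -/
structure IsReachedState (t : Fin n → G) (b : J → Multiplicative (C → ℤ) →* G)
    (P : J → Subgroup (Multiplicative (C → ℤ))) (k : ℕ) (g : G) (v : Perm J)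
    (m : Block n J → ℤ × (C → ℤ)) : Prop where
  pos : IsPositiveState (Block.Interacts D) m
  basis : ∀ s, ¬ IsCompatible m (.edge v s) (Pi.single c₀ 1) →
    ∃ k' < k, HasLength t b P k' (t s * g)
  basis_inv : ∀ s, ¬ IsCompatible m (.edge (v * τ s) s) (-Pi.single c₀ 1) →
    ∃ k' < k, HasLength t b P k' ((t s)⁻¹ * g)
  torus : ∀ j, ¬ IsNeutral m (.torus (v j)) → ∀ a ∈ P j, ∃ k' ≤ k, HasLength t b P k' (b j a * g)
  not_isNeutral : 0 < k → ∃ h, ¬ IsNeutral m h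

variable {c₀ τ D}

/-! ### Prolonging a shortest word by one syllable -/

section

variable {t : Fin n → G} {b : J → Multiplicative (C → ℤ) →* G}
  {P : J → Subgroup (Multiplicative (C → ℤ))} {k : ℕ} {g : G} {v : Perm J}
  {m : Block n J → ℤ × (C → ℤ)}

/-- Only one value of the function is followed, and its position moves from `v` to `v * (τ s)⁻¹`.
Blocks interacting with the edge become neutral and so impose nothing. The edge itself can only be
undone by `(t s)⁻¹`. A torus that does not interact keeps its state, and its element can be moved
past `t s` by `hrel`. -/
theorem IsReachedState.basis_mul (hrel : ∀ s, ∀ j ∈ D s, ∀ a, t s * b j a * (t s)⁻¹ = b (τ s j) a)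
    (hP : ∀ s, ∀ j ∈ D s, P (τ s j) = P j) (h : IsReachedState c₀ τ D t b P k g v m) (s : Fin n)
    (hg : HasLength t b P k g) (hmin : ∀ k' < k + 1, ¬ HasLength t b P k' (t s * g)) :
    IsReachedState c₀ τ D t b P (k + 1) (t s * g) (v * (τ s)⁻¹)
      (blockMap (Block.Interacts D) (.edge v s) (Pi.single c₀ 1) m) := by
  have hI := Block.not_interacts_self D
  have hd := h.pos.pos (.edge v s)
  have h0 : (Pi.single c₀ 1 : C → ℤ) ≠ 0 := by simp
  have hc : IsCompatible m (.edge v s) (Pi.single c₀ 1) := by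
    by_contra hc
    obtain ⟨k', hk', h'⟩ := h.basis s hc
    exact hmin k' (by lia) h'
  have hn : ∀ x, Block.Interacts D (.edge v s) x →
      IsNeutral (blockMap (Block.Interacts D) (.edge v s) (Pi.single c₀ 1) m) x :=
    fun x hx => h.pos.isNeutral_blockMap _ hI hc h0 hx
  refine ⟨h.pos.blockMap _ hI (Block.Interacts.symm D) hc, fun s' hs' => ?_, fun s' hs' => ?_,
    fun j hj a ha => ?_, fun _ => ⟨_, hc.not_isNeutral _ hI hd h0⟩⟩
  · exfalso
    by_cases he : v = v * (τ s)⁻¹ ∧ s = s'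
    · rw [← he.1, ← he.2] at hs'
      exact hs' (hc.blockMap_self _ hI hd)
    · exact hs' ((hn (.edge _ _) he).isCompatible _)
  · by_cases he : v = v * (τ s)⁻¹ * τ s' ∧ s = s'
    · obtain rfl := he.2
      exact ⟨k, by lia, by simpa using hg⟩
    · exact absurd ((hn (.edge _ _) he).isCompatible _) hs'
  · by_cases hI' : v⁻¹ ((v * (τ s)⁻¹) j) ∈ D s
    · obtain ⟨j, rfl⟩ := (τ s).surjective j
      simp only [Equiv.Perm.mul_apply, Equiv.Perm.inv_def, Equiv.symm_apply_apply] at hI' hj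
      rw [isNeutral_congr (blockMap_of_not_interacting _ (by simp) (by simpa [Block.Interacts])
        _ _)] at hj
      rw [hP s j hI'] at ha
      obtain ⟨k', hk', h'⟩ := h.torus j hj a ha
      refine ⟨k' + 1, by lia, ?_⟩
      have := h'.basis s
      rwa [← mul_assoc, mul_inv_eq_iff_eq_mul.1 (hrel s j hI' a), mul_assoc] at this
    · exact absurd (hn (.torus _) hI') hj

theorem IsReachedState.basis_inv_mul
    (hrel : ∀ s, ∀ j ∈ D s, ∀ a, t s * b j a * (t s)⁻¹ = b (τ s j) a)
    (hP : ∀ s, ∀ j ∈ D s, P (τ s j) = P j) (h : IsReachedState c₀ τ D t b P k g v m) (s : Fin n)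
    (hg : HasLength t b P k g) (hmin : ∀ k' < k + 1, ¬ HasLength t b P k' ((t s)⁻¹ * g)) :
    IsReachedState c₀ τ D t b P (k + 1) ((t s)⁻¹ * g) (v * τ s)
      (blockMap (Block.Interacts D) (.edge (v * τ s) s) (-Pi.single c₀ 1) m) := by
  have hI := Block.not_interacts_self D
  have hd := h.pos.pos (.edge (v * τ s) s)
  have h0 : (-Pi.single c₀ 1 : C → ℤ) ≠ 0 := by simp
  have hc : IsCompatible m (.edge (v * τ s) s) (-Pi.single c₀ 1) := by
    by_contra hc
    obtain ⟨k', hk', h'⟩ := h.basis_inv s hc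
    exact hmin k' (by lia) h'
  have hn : ∀ x, Block.Interacts D (.edge (v * τ s) s) x →
      IsNeutral (blockMap (Block.Interacts D) (.edge (v * τ s) s) (-Pi.single c₀ 1) m) x :=
    fun x hx => h.pos.isNeutral_blockMap _ hI hc h0 hx
  refine ⟨h.pos.blockMap _ hI (Block.Interacts.symm D) hc, fun s' hs' => ?_, fun s' hs' => ?_,
    fun j hj a ha => ?_, fun _ => ⟨_, hc.not_isNeutral _ hI hd h0⟩⟩
  · by_cases he : v * τ s = v * τ s ∧ s = s'
    · obtain rfl := he.2
      exact ⟨k, by lia, by simpa using hg⟩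
    · exact absurd ((hn (.edge _ _) he).isCompatible _) hs'
  · exfalso
    by_cases he : v * τ s = v * τ s * τ s' ∧ s = s'
    · rw [← he.1, ← he.2] at hs'
      exact hs' (hc.blockMap_self _ hI hd)
    · exact hs' ((hn (.edge _ _) he).isCompatible _)
  · by_cases hI' : (v * τ s)⁻¹ ((v * τ s) j) ∈ D s
    · rw [isNeutral_congr (blockMap_of_not_interacting _ (by simp)
        (by simpa only [Block.Interacts, not_not] using hI') _ _)] at hj
      rw [Equiv.Perm.inv_def, Equiv.symm_apply_apply] at hI'
      rw [← hP s j hI'] at ha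
      obtain ⟨k', hk', h'⟩ := h.torus (τ s j) hj a ha
      refine ⟨k' + 1, by lia, ?_⟩
      have := h'.basis_inv s
      rwa [← hrel s j hI' a, show (t s)⁻¹ * (t s * b j a * (t s)⁻¹ * g) = b j a * ((t s)⁻¹ * g) by
        group] at this
    · exact absurd (hn (.torus _) hI') hj

theorem IsReachedState.torus_mul
    (hrel : ∀ s, ∀ j ∈ D s, ∀ a, t s * b j a * (t s)⁻¹ = b (τ s j) a)
    (hP : ∀ s, ∀ j ∈ D s, P (τ s j) = P j) (h : IsReachedState c₀ τ D t b P k g v m) (j : J)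
    {a : Multiplicative (C → ℤ)} (ha : a ∈ P j)
    (hg : HasLength t b P k g) (hmin : ∀ k' < k + 1, ¬ HasLength t b P k' (b j a * g)) :
    IsReachedState c₀ τ D t b P (k + 1) (b j a * g) v
      (blockMap (Block.Interacts D) (.torus (v j)) a.toAdd m) := by
  have hI := Block.not_interacts_self D
  have hd := h.pos.pos (.torus (v j))
  have h0 : a.toAdd ≠ 0 := by
    intro h0
    obtain rfl : a = 1 := h0
    exact hmin k (by lia) (by simpa using hg)
  have hc : IsCompatible m (.torus (v j)) a.toAdd := by
    refine IsNeutral.isCompatible ?_ _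
    by_contra hc
    obtain ⟨k', hk', h'⟩ := h.torus j hc a ha
    exact hmin k' (by lia) h'
  have hn : ∀ x, Block.Interacts D (.torus (v j)) x →
      IsNeutral (blockMap (Block.Interacts D) (.torus (v j)) a.toAdd m) x :=
    fun x hx => h.pos.isNeutral_blockMap _ hI hc h0 hx
  refine ⟨h.pos.blockMap _ hI (Block.Interacts.symm D) hc, fun s hs => ?_, fun s hs => ?_,
    fun j' hj a' ha' => ?_, fun _ => ⟨_, hc.not_isNeutral _ hI hd h0⟩⟩
  · by_cases hI' : v⁻¹ (v j) ∈ D s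
    · rw [isCompatible_congr (blockMap_of_not_interacting _ (by simp)
        (by simpa only [Block.Interacts, not_not] using hI') _ _)] at hs
      rw [Equiv.Perm.inv_def, Equiv.symm_apply_apply] at hI'
      obtain ⟨k', hk', h'⟩ := h.basis s hs
      refine ⟨k' + 1, by lia, ?_⟩
      have := h'.torus (τ s j) ((hP s j hI').symm ▸ ha)
      rwa [← hrel s j hI' a, show t s * b j a * (t s)⁻¹ * (t s * g) = t s * (b j a * g) by
        group] at this
    · exact absurd ((hn (.edge _ _) hI').isCompatible _) hs
  · by_cases hI' : (v * τ s)⁻¹ (v j) ∈ D s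
    · rw [isCompatible_congr (blockMap_of_not_interacting _ (by simp)
        (by simpa only [Block.Interacts, not_not] using hI') _ _)] at hs
      obtain ⟨j, rfl⟩ := (τ s).surjective j
      simp only [mul_inv_rev, Equiv.Perm.mul_apply, Equiv.Perm.inv_def, Equiv.symm_apply_apply] at hI'
      obtain ⟨k', hk', h'⟩ := h.basis_inv s hs
      refine ⟨k' + 1, by lia, ?_⟩
      have := h'.torus j ((hP s j hI') ▸ ha)
      rwa [← hrel s j hI' a, show (t s)⁻¹ * (t s * b j a * (t s)⁻¹ * g) = b j a * ((t s)⁻¹ * g) by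
        group]
    · exact absurd ((hn (.edge _ _) hI').isCompatible _) hs
  · by_cases he : v j = v j'
    · obtain rfl := v.injective he
      -- A second element of the same torus merges with `a` into one syllable; hence `torus` asks
      -- for `≤` rather than `<`.
      refine ⟨k + 1, le_rfl, ?_⟩
      rw [← mul_assoc, ← map_mul]
      exact hg.torus j (mul_mem ha' ha)
    · exact absurd (hn (.torus _) he) hj

end

variable (c₀) in
/-- A group generated by elements `t s` and tori `b j (P j)` that are permuted partially by the
`t s` acts faithfully on `RepModule n J C`, if it acts there at all. -/
theorem injective_of_partial_action {t : Fin n → G} {b : J → Multiplicative (C → ℤ) →* G}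
    {P : J → Subgroup (Multiplicative (C → ℤ))}
    (hgen : Subgroup.closure (Set.range t ∪ {x | ∃ j, ∃ a ∈ P j, b j a = x}) = ⊤)
    (hrel : ∀ s, ∀ j ∈ D s, ∀ a, t s * b j a * (t s)⁻¹ = b (τ s j) a)
    (hP : ∀ s, ∀ j ∈ D s, P (τ s j) = P j)
    (Φ : G →* (RepModule n J C ≃ₗ[ℤ] RepModule n J C))
    (hΦt : ∀ s, Φ (t s) = edgeAut c₀ τ D s)
    (hΦb : ∀ j, ∀ a ∈ P j, Φ (b j a) = torusAut D j a) :
    Function.Injective Φ := by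
  -- All blocks are neutral here, so an element with a non-neutral block in the image of `f₀` cannot
  -- act trivially.
  let f₀ : RepModule n J C := fun _ _ => (1, 0)
  have key : ∀ k g, HasLength t b P k g → (∀ k' < k, ¬ HasLength t b P k' g) →
      ∃ v, IsReachedState c₀ τ D t b P k g v (Φ g f₀ v) := by
    intro k g hg
    induction hg with
    | one =>
      intro _
      have hneut : ∀ h, IsNeutral (f₀ 1) h := fun h c => by simp [f₀]
      refine ⟨1, ?_⟩
      rw [map_one]
      exact ⟨⟨fun _ => by simp [f₀], fun _ _ _ _ _ => by simp [f₀]⟩,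
        fun s hs => absurd ((hneut _).isCompatible _) hs,
        fun s hs => absurd ((hneut _).isCompatible _) hs,
        fun j hj => absurd (hneut _) hj, fun h => absurd h (lt_irrefl 0)⟩
    | @basis k g s hg ih =>
      intro hmin
      obtain ⟨v, hv⟩ := ih fun k' hk' h' => hmin (k' + 1) (by lia) (h'.basis s)
      refine ⟨v * (τ s)⁻¹, ?_⟩
      convert hv.basis_mul hrel hP s hg hmin using 1
      rw [map_mul, hΦt, LinearEquiv.mul_apply, edgeAut_apply, inv_mul_cancel_right]
    | @basis_inv k g s hg ih =>
      intro hmin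
      obtain ⟨v, hv⟩ := ih fun k' hk' h' => hmin (k' + 1) (by lia) (h'.basis_inv s)
      refine ⟨v * τ s, ?_⟩
      convert hv.basis_inv_mul hrel hP s hg hmin using 1
      rw [map_mul, map_inv, hΦt, LinearEquiv.mul_apply, edgeAut_inv_apply, mul_inv_cancel_right]
    | @torus k g j a ha hg ih =>
      intro hmin
      obtain ⟨v, hv⟩ := ih fun k' hk' h' => hmin (k' + 1) (by lia) (h'.torus j ha)
      refine ⟨v, ?_⟩
      convert hv.torus_mul hrel hP j ha hg hmin using 1
      rw [map_mul, hΦb j a ha, LinearEquiv.mul_apply, torusAut_apply]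
  refine (injective_iff_map_eq_one Φ).2 fun g hg => ?_
  classical
  have hex := exists_hasLength hgen g
  obtain ⟨v, hv⟩ := key _ g (Nat.find_spec hex) fun k' hk' => Nat.find_min hex hk'
  rcases Nat.eq_zero_or_pos (Nat.find hex) with h0 | h0
  · have := Nat.find_spec hex
    rw [h0] at this
    cases this
    rfl
  · obtain ⟨h, hh⟩ := hv.not_isNeutral h0
    rw [hg] at hh
    exact absurd (fun c => by simp [f₀]) hh

end Representation

/-! ### Cyclically reduced words and partial permutations -/

section CyclicWords

open Equiv (Perm)

/-- Indices in `Fin (l + 1)` are cyclic: the step from the last position back to 0 is where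
commuting with the whole product is needed. `commute_of_conj` is the converse. -/
theorem partialProd_castSucc_add_one {K : Type*} [Group K] {l : ℕ} (z : Fin (l + 1) → K)
    (c : K) (hc : Commute c (List.ofFn z).prod) (κ : Fin (l + 1)) :
    z κ * ((Fin.partialProd z (κ + 1).castSucc)⁻¹ * c * Fin.partialProd z (κ + 1).castSucc) *
      (z κ)⁻¹ = (Fin.partialProd z κ.castSucc)⁻¹ * c * Fin.partialProd z κ.castSucc := by
  have hs := Fin.partialProd_succ z κ
  induction κ using Fin.lastCases with
  | last =>
    have hU : Fin.partialProd z (Fin.last (l + 1)) = (List.ofFn z).prod := by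
      simp [Fin.partialProd, List.take_of_length_le]
    rw [Fin.succ_last, hU] at hs
    rw [Fin.last_add_one, Fin.castSucc_zero, Fin.partialProd_zero]
    rw [hs] at hc
    have := hc.eq
    simp only [inv_one, one_mul, mul_one]
    rw [eq_comm, mul_assoc, inv_mul_eq_iff_eq_mul, ← mul_assoc, ← mul_assoc, eq_mul_inv_iff_mul_eq,
      mul_assoc, this]
  | cast κ =>
    rw [Fin.coeSucc_eq_succ, ← Fin.succ_castSucc, hs]
    group

theorem eq_conj_partialProd {K : Type*} [Group K] {l : ℕ} (z b : Fin (l + 1) → K)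
    (h : ∀ κ, z κ * b (κ + 1) * (z κ)⁻¹ = b κ) (κ : Fin (l + 1)) :
    b κ = (Fin.partialProd z κ.castSucc)⁻¹ * b 0 * Fin.partialProd z κ.castSucc := by
  induction κ using Fin.induction with
  | zero => simp
  | succ κ ih =>
    have := h κ.castSucc
    rw [ih, Fin.coeSucc_eq_succ] at this
    rw [← Fin.succ_castSucc, Fin.partialProd_succ, mul_inv_rev,
      ← mul_right_inj (z κ.castSucc), ← mul_left_inj (z κ.castSucc)⁻¹, this]
    group

theorem commute_of_conj {K : Type*} [Group K] {l : ℕ} (z b : Fin (l + 1) → K)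
    (h : ∀ κ, z κ * b (κ + 1) * (z κ)⁻¹ = b κ) : Commute (b 0) (List.ofFn z).prod := by
  have hU : Fin.partialProd z (Fin.last (l + 1)) = (List.ofFn z).prod := by
    simp [Fin.partialProd, List.take_of_length_le]
  have h1 := eq_conj_partialProd z b h (Fin.last l)
  have h2 := h (Fin.last l)
  rw [Fin.last_add_one, h1] at h2
  rw [← hU, ← Fin.succ_last, Fin.partialProd_succ]
  set p := Fin.partialProd z (Fin.last l).castSucc
  have h3 : p * (z (Fin.last l) * b 0 * (z (Fin.last l))⁻¹) = b 0 * p := by rw [h2]; group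
  rw [Commute, SemiconjBy, ← mul_assoc, ← h3]
  group

open FreeGroup in
/-- A nontrivial element of a free group is conjugate to one given by a cyclically reduced word. -/
theorem FreeGroup.exists_cyclic_word {α : Type*} (u : FreeGroup α) (hu : u ≠ 1) :
    ∃ (l : ℕ) (y : Fin (l + 1) → α × Bool) (c : FreeGroup α),
      u = c * FreeGroup.mk (List.ofFn y) * c⁻¹ ∧
      ∀ κ, (y κ).1 = (y (κ + 1)).1 → (y κ).2 = (y (κ + 1)).2 := by
  classical
  have hcyc := reduceCyclically.isCyclicallyReduced (isReduced_toWord (x := u))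
  have hconj := reduceCyclically.conj_conjugator_reduceCyclically u.toWord
  generalize reduceCyclically.conjugator u.toWord = d at hconj
  generalize reduceCyclically u.toWord = w at hcyc hconj
  have hu' : u = mk d * mk w * (mk d)⁻¹ := by
    rw [inv_mk, mul_mk, mul_mk, hconj, mk_toWord]
  cases w with
  | nil => exact absurd (by rw [hu', ← one_eq_mk]; group) hu
  | cons x w =>
    refine ⟨w.length, fun κ => (x :: w)[κ], mk d, ?_, fun κ => ?_⟩
    · rw [hu']
      congr
      exact List.ofFn_getElem.symm
    · induction κ using Fin.lastCases with
      -- The wrap-around from the last letter to the first is the cyclic part of cyclic reducedness.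
      | last =>
        rw [Fin.last_add_one]
        refine hcyc.2 _ ?_ _ (by simp)
        simp [List.getLast?_eq_getElem?]
      | cast κ =>
        rw [Fin.coeSucc_eq_succ]
        exact List.isChain_iff_getElem.1 hcyc.isReduced κ (by simp)

/-- A functional and injective relation on a finite type extends to a permutation. -/
theorem exists_perm_of_relation {J : Type*} [Finite J] (R : J → J → Prop)
    (hfun : ∀ j k k', R j k → R j k' → k = k') (hinj : ∀ j j' k, R j k → R j' k → j = j') :
    ∃ σ : Perm J, ∀ j k, R j k → σ j = k := by
  classical
  choose f hf using fun j : {j // ∃ k, R j k} => j.2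
  let e : {j // ∃ k, R j k} ≃ {k // ∃ j, R j k} := Equiv.ofBijective
    (fun j => ⟨f j, j, hf j⟩) ⟨fun j j' h => Subtype.ext
      (hinj _ _ (f j) (hf j) (by rw [show f j = f j' from congrArg Subtype.val h]; exact hf j')),
      fun ⟨k, j, hj⟩ => ⟨⟨j, k, hj⟩, Subtype.ext (hfun j _ _ (hf ⟨j, k, hj⟩) hj)⟩⟩
  have := Fintype.ofFinite J
  refine ⟨e.extendSubtype, fun j k hjk => ?_⟩
  rw [e.extendSubtype_apply_of_mem j ⟨k, hjk⟩]
  exact hfun j _ _ (hf ⟨j, k, hjk⟩) hjk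

/-- The relation by which the basis element `s` moves the positions in a family of cyclic words. -/
def CyclicShift {ι α : Type*} {l : ι → ℕ} (y : ∀ i, Fin (l i + 1) → α × Bool) (s : α)
    (j k : Σ i, Fin (l i + 1)) : Prop :=
  (∃ i κ, j = ⟨i, κ + 1⟩ ∧ k = ⟨i, κ⟩ ∧ y i κ = (s, true)) ∨
    ∃ i κ, j = ⟨i, κ⟩ ∧ k = ⟨i, κ + 1⟩ ∧ y i κ = (s, false)

/-- Two conflicting moves of one position under `s` would need `s` and its inverse as cyclically
adjacent letters, which `hy` forbids. -/
theorem exists_perm_cyclicShift {ι α : Type*} [Finite ι] {l : ι → ℕ}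
    (y : ∀ i, Fin (l i + 1) → α × Bool)
    (hy : ∀ i κ, (y i κ).1 = (y i (κ + 1)).1 → (y i κ).2 = (y i (κ + 1)).2) (s : α) :
    ∃ σ : Perm (Σ i, Fin (l i + 1)), ∀ j k, CyclicShift y s j k → σ j = k := by
  refine exists_perm_of_relation _ ?_ ?_
  · rintro j k k' (⟨i, κ, rfl, rfl, h⟩ | ⟨i, κ, rfl, rfl, h⟩)
      (⟨i', κ', e, rfl, h'⟩ | ⟨i', κ', e, rfl, h'⟩) <;> obtain rfl := congrArg Sigma.fst e <;>
      obtain e' := eq_of_heq (Sigma.mk.inj e).2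
    · rw [add_right_cancel e']
    · subst e'
      have := hy i κ
      simp [h, h'] at this
    · have := hy i κ'
      simp [h, h', ← e'] at this
    · rw [e']
  · rintro j j' k (⟨i, κ, rfl, rfl, h⟩ | ⟨i, κ, rfl, rfl, h⟩)
      (⟨i', κ', rfl, e, h'⟩ | ⟨i', κ', rfl, e, h'⟩) <;> obtain rfl := congrArg Sigma.fst e <;>
      obtain e' := eq_of_heq (Sigma.mk.inj e).2
    · rw [e']
    · have := hy i κ'
      simp [h, h', ← e'] at this
    · subst e'
      have := hy i κ
      simp [h, h'] at this
    · rw [add_right_cancel e']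

end CyclicWords

/-! ### Linear groups and primitive elements -/

theorem IsZLinear.of_injective {G M : Type*} [Group G] [AddCommGroup M] [Module.Free ℤ M]
    [Module.Finite ℤ M] (Φ : G →* (M ≃ₗ[ℤ] M)) (hΦ : Function.Injective Φ) : IsZLinear G := by
  let e := LinearMap.toMatrixAlgEquiv (Module.finBasis ℤ M)
  let E : (M ≃ₗ[ℤ] M) ≃* Matrix.GeneralLinearGroup (Fin (Module.finrank ℤ M)) ℤ :=
    (LinearMap.GeneralLinearGroup.generalLinearEquiv ℤ M).symm.trans
      (Units.mapEquiv (e : (M →ₗ[ℤ] M) ≃* _))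
  exact ⟨_, E.toMonoidHom.comp Φ, E.injective.comp hΦ⟩

instance {n : ℕ} {J : Type*} [Finite J] : Finite (Block n J) :=
  Finite.of_surjective (fun x : (Equiv.Perm J × Fin n) ⊕ J =>
    x.elim (fun p => Block.edge p.1 p.2) Block.torus) fun g => by
      cases g with
      | edge v s => exact ⟨.inl (v, s), rfl⟩
      | torus O => exact ⟨.inr O, rfl⟩

/-- A group with a primitive element `w` is the product of `⟨w⟩` and a complement; `ev` is the
coordinate of `w`, and `E` and `S` describe the complement. -/
theorem IsPrimitiveElement.exists_complement {Z : Type*} [Group Z] {w : Z}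
    (hw : IsPrimitiveElement w) :
    (∀ a b : Z, a * b = b * a) ∧ ∃ (r : ℕ) (ev : Z →* Multiplicative ℤ)
      (E : Z →* Multiplicative (Fin r → ℤ)) (S : Multiplicative (Fin r → ℤ) →* Z),
      ev w = Multiplicative.ofAdd 1 ∧ E w = 1 ∧ ∀ z, S (E z) = z * (w ^ (ev z).toAdd)⁻¹ := by
  obtain ⟨r, φ, j, hφ⟩ := hw
  refine ⟨fun a b => φ.injective (by rw [map_mul, map_mul, mul_comm]), r,
    (AddMonoidHom.toMultiplicative (Pi.evalAddMonoidHom (fun _ => ℤ) j)).comp φ.toMonoidHom,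
    -- `E` kills coordinate `j` without lowering the rank, so `φ.symm` serves as `S`; only the range
    -- of `E` represents the complement.
    (AddMonoidHom.toMultiplicative (LinearMap.id - (LinearMap.proj (R := ℤ) j).smulRight
      (Pi.single j 1 : Fin r → ℤ) : (Fin r → ℤ) →ₗ[ℤ] (Fin r → ℤ)).toAddMonoidHom).comp
      φ.toMonoidHom, φ.symm.toMonoidHom, ?_, ?_, fun z => ?_⟩
  · simp [hφ]
  · simp [hφ]
  · apply φ.injective
    simp [hφ, div_eq_mul_inv, ← ofAdd_zsmul, zsmul_eq_mul]

/-! ### Stars with a free central group and free abelian external groups -/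

section Star

open Equiv (Perm)

theorem map_partialProd {K L : Type*} [Group K] [Group L] (f : K →* L) {l : ℕ} (z : Fin l → K)
    (j : Fin (l + 1)) : f (Fin.partialProd z j) = Fin.partialProd (fun κ => f (z κ)) j := by
  induction j using Fin.induction with
  | zero => simp
  | succ j ih => rw [Fin.partialProd_succ, Fin.partialProd_succ, map_mul, ih]

/-- Used in both directions: in the given group it turns relations along the words into relations
for basis elements, and among the automorphisms the reverse. -/
theorem cyclicShift_relations_iff {ι α K : Type*} [Group K] {l : ι → ℕ}
    (y : ∀ i, Fin (l i + 1) → α × Bool) (f : FreeGroup α →* K) (β : (Σ i, Fin (l i + 1)) → K) :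
    (∀ i κ, f (FreeGroup.mk [y i κ]) * β ⟨i, κ + 1⟩ * (f (FreeGroup.mk [y i κ]))⁻¹ = β ⟨i, κ⟩) ↔
      ∀ s j k, CyclicShift y s j k →
        f (FreeGroup.of s) * β j * (f (FreeGroup.of s))⁻¹ = β k := by
  have hfalse : ∀ s : α, FreeGroup.mk [(s, false)] = (FreeGroup.of s)⁻¹ := fun s => rfl
  have htrue : ∀ s : α, FreeGroup.mk [(s, true)] = FreeGroup.of s := fun s => rfl
  constructor
  · rintro h s j k (⟨i, κ, rfl, rfl, e⟩ | ⟨i, κ, rfl, rfl, e⟩)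
    · simpa [e, htrue] using h i κ
    · rw [← h i κ, e, hfalse, map_inv]
      group
  · intro h i κ
    rcases e : y i κ with ⟨s, _ | _⟩
    · rw [← h s _ _ (.inr ⟨i, κ, rfl, rfl, e⟩), hfalse, map_inv]
      group
    · exact h s _ _ (.inl ⟨i, κ, rfl, rfl, e⟩)

theorem map_mk_ofFn {α K : Type*} [Group K] (f : FreeGroup α →* K) {l : ℕ} (y : Fin l → α × Bool) :
    (List.ofFn fun κ => f (FreeGroup.mk [y κ])).prod = f (FreeGroup.mk (List.ofFn y)) := by
  induction l with
  | zero => simp [← FreeGroup.one_eq_mk]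
  | succ l ih =>
    rw [List.ofFn_succ, List.prod_cons, ih, List.ofFn_succ, ← map_mul, FreeGroup.mul_mk]
    rfl

/-- The complements of a finite family of primitive elements, all inside one free abelian group. -/
theorem exists_complements {ι : Type} [Fintype ι] {Z : ι → Type*} [∀ i, Group (Z i)]
    {w : ∀ i, Z i} (hw : ∀ i, IsPrimitiveElement (w i)) :
    ∃ (C : Type) (_ : Fintype C) (_ : DecidableEq C) (_ : C) (ev : ∀ i, Z i →* Multiplicative ℤ)
      (E : ∀ i, Z i →* Multiplicative (C → ℤ)) (S : ∀ i, Multiplicative (C → ℤ) →* Z i),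
      ∀ i, ev i (w i) = Multiplicative.ofAdd 1 ∧ E i (w i) = 1 ∧
        ∀ z, S i (E i z) = z * (w i ^ (ev i z).toAdd)⁻¹ := by
  classical
  choose r ev E S hev hE hS using fun i => (hw i).exists_complement.2
  -- The extra point `none` becomes `c₀`, the coordinate in which edges act; it exists even when the
  -- family is empty.
  let emb : ∀ i, Fin (r i) → Option (Σ i, Fin (r i)) := fun i x => some ⟨i, x⟩
  have hemb : ∀ i, Function.Injective (emb i) := fun i x x' h => by simpa [emb] using h
  refine ⟨Option (Σ i, Fin (r i)), inferInstance, inferInstance, none, ev,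
    fun i => (AddMonoidHom.toMultiplicative
      (Function.ExtendByZero.linearMap ℤ (emb i)).toAddMonoidHom).comp (E i),
    fun i => (S i).comp (AddMonoidHom.toMultiplicative
      (LinearMap.funLeft ℤ ℤ (emb i)).toAddMonoidHom),
    fun i => ⟨hev i, by simp [hE i], fun z => ?_⟩⟩
  rw [← hS i z]
  refine congrArg (S i) (Multiplicative.toAdd.injective (funext fun x => ?_))
  exact (hemb i).extend_apply _ _ x

/-- A group with the universal property of the fundamental group of a star of groups is
`ℤ`-linear, if the central group is free of finite rank and the edge groups are generated by
nontrivial elements of the central group and primitive elements of free abelian groups. -/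
theorem isZLinear_of_star {n m : ℕ} {G : Type*} [Group G] {Z : Fin m → Type*} [∀ i, Group (Z i)]
    {w : ∀ i, Z i} (hw : ∀ i, IsPrimitiveElement (w i)) {u : Fin m → FreeGroup (Fin n)}
    (hu : ∀ i, u i ≠ 1) {ν₀ : FreeGroup (Fin n) →* G} {ν : ∀ i, Z i →* G}
    (hν : ∀ i, ν₀ (u i) = ν i (w i))
    (hgen : ∀ K : Subgroup G, (∀ x, ν₀ x ∈ K) → (∀ i z, ν i z ∈ K) → K = ⊤)
    (hlift : ∀ (H : Type) [Group H] (f₀ : FreeGroup (Fin n) →* H) (f : ∀ i, Z i →* H),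
      (∀ i, f₀ (u i) = f i (w i)) → ∃ Φ : G →* H, (∀ x, Φ (ν₀ x) = f₀ x) ∧
        ∀ i z, Φ (ν i z) = f i z) :
    IsZLinear G := by
  obtain ⟨C, _, _, c₀, ev, E, S, hES⟩ := exists_complements hw
  choose hev hE hS using hES
  choose l y c huc hy using fun i => (u i).exists_cyclic_word (hu i)
  choose τ hτ using exists_perm_cyclicShift y hy
  let D : Fin n → Set (Σ i, Fin (l i + 1)) := fun s => {j | ∃ k, CyclicShift y s j k}
  have hfst : ∀ s j k, CyclicShift y s j k → k.1 = j.1 := by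
    rintro s j k (⟨i, κ, rfl, rfl, -⟩ | ⟨i, κ, rfl, rfl, -⟩) <;> rfl
  let p : ∀ i, Fin (l i + 1) → FreeGroup (Fin n) := fun i κ =>
    Fin.partialProd (fun κ => FreeGroup.mk [y i κ]) κ.castSucc
  -- The complement conjugated by the prefix before the given position, and by `c i` since `u i` is
  -- only conjugate to its cyclic word.
  let b : (Σ i, Fin (l i + 1)) → Multiplicative (C → ℤ) →* G := fun j =>
    (MulAut.conj (ν₀ (c j.1 * p j.1 j.2))⁻¹).toMonoidHom.comp ((ν j.1).comp (S j.1))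
  have hb : ∀ i κ a, b ⟨i, κ⟩ a =
      (ν₀ (p i κ))⁻¹ * ((ν₀ (c i))⁻¹ * ν i (S i a) * ν₀ (c i)) * ν₀ (p i κ) := by
    intro i κ a
    simp [b, mul_assoc]
  have hcomm : ∀ i a, Commute ((ν₀ (c i))⁻¹ * ν i (S i a) * ν₀ (c i))
      (ν₀ (FreeGroup.mk (List.ofFn (y i)))) := by
    intro i a
    have h1 : ν i (S i a) * ν₀ (u i) = ν₀ (u i) * ν i (S i a) := by
      rw [hν, ← map_mul, ← map_mul, (hw i).exists_complement.1]
    have h2 : ν₀ (FreeGroup.mk (List.ofFn (y i))) = (ν₀ (c i))⁻¹ * ν₀ (u i) * ν₀ (c i) := by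
      rw [← map_inv, ← map_mul, ← map_mul, huc i]
      congr 1
      group
    rw [h2]
    calc (ν₀ (c i))⁻¹ * ν i (S i a) * ν₀ (c i) * ((ν₀ (c i))⁻¹ * ν₀ (u i) * ν₀ (c i))
        = (ν₀ (c i))⁻¹ * (ν i (S i a) * ν₀ (u i)) * ν₀ (c i) := by group
      _ = _ := by rw [h1]; group
  have hrel : ∀ s, ∀ j ∈ D s, ∀ a, ν₀ (.of s) * b j a * (ν₀ (.of s))⁻¹ = b (τ s j) a := by
    rintro s j ⟨k, hk⟩ a
    rw [hτ s j k hk]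
    refine (cyclicShift_relations_iff y ν₀ fun j => b j a).1 (fun i κ => ?_) s j k hk
    have := partialProd_castSucc_add_one (fun κ => ν₀ (FreeGroup.mk [y i κ]))
      ((ν₀ (c i))⁻¹ * ν i (S i a) * ν₀ (c i)) (by rw [map_mk_ofFn]; exact hcomm i a) κ
    simp only [← map_partialProd] at this
    rw [hb, hb]
    exact this
  have hP : ∀ s, ∀ j ∈ D s, (E (τ s j).1).range = (E j.1).range := by
    rintro s j ⟨k, hk⟩
    rw [hτ s j k hk, hfst s j k hk]
  have hgen' : Subgroup.closure (Set.range (fun s => ν₀ (.of s)) ∪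
      {x | ∃ j, ∃ a ∈ (E j.1).range, b j a = x}) = ⊤ := by
    set K := Subgroup.closure (Set.range (fun s => ν₀ (.of s)) ∪
      {x | ∃ j, ∃ a ∈ (E j.1).range, b j a = x})
    have hK₀ : ∀ x, ν₀ x ∈ K := by
      intro x
      induction x using FreeGroup.induction_on with
      | C1 => rw [map_one]; exact one_mem K
      | of s => exact Subgroup.subset_closure (.inl ⟨s, rfl⟩)
      | inv_of s h => rw [map_inv]; exact inv_mem h
      | mul x x' h h' => rw [map_mul]; exact mul_mem h h'
    refine hgen K hK₀ fun i z => ?_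
    have h1 : b ⟨i, 0⟩ (E i z) ∈ K := Subgroup.subset_closure (.inr ⟨⟨i, 0⟩, E i z, ⟨z, rfl⟩, rfl⟩)
    rw [hb, hS] at h1
    have h2 : ν i z = ν₀ (c i * p i 0) * ((ν₀ (p i 0))⁻¹ * ((ν₀ (c i))⁻¹ *
        ν i (z * (w i ^ (ev i z).toAdd)⁻¹) * ν₀ (c i)) * ν₀ (p i 0)) * (ν₀ (c i * p i 0))⁻¹ *
        ν₀ (u i) ^ (ev i z).toAdd := by
      rw [hν, map_mul, map_mul, map_inv, map_zpow]
      group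
    rw [h2]
    exact mul_mem (mul_mem (mul_mem (hK₀ _) h1) (inv_mem (hK₀ _))) (zpow_mem (hK₀ _) _)
  let f₀ : FreeGroup (Fin n) →* (RepModule n (Σ i, Fin (l i + 1)) C ≃ₗ[ℤ] RepModule n _ C) :=
    FreeGroup.lift (edgeAut c₀ τ D)
  have hrel' : ∀ i κ a, f₀ (FreeGroup.mk [y i κ]) * torusAut D ⟨i, κ + 1⟩ a *
      (f₀ (FreeGroup.mk [y i κ]))⁻¹ = torusAut D ⟨i, κ⟩ a := by
    intro i κ a
    refine (cyclicShift_relations_iff y f₀ fun j => torusAut D j a).2 (fun s j k hk => ?_) i κ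
    rw [← hτ s j k hk]
    simpa [f₀] using edgeAut_conj_torusAut c₀ τ D (s := s) (j := j) ⟨k, hk⟩ a
  have hcomm' : ∀ i a, Commute (f₀ (u i)) (f₀ (c i) * torusAut D ⟨i, 0⟩ a * (f₀ (c i))⁻¹) := by
    intro i a
    have h1 := commute_of_conj _ (fun κ => torusAut D ⟨i, κ⟩ a) (fun κ => hrel' i κ a)
    rw [map_mk_ofFn] at h1
    rw [huc i, map_mul, map_mul, map_inv, ← MulAut.conj_apply, ← MulAut.conj_apply]
    exact (h1.map (MulAut.conj (f₀ (c i))).toMonoidHom).symm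
  -- On ⟨w i⟩ × complement: `w i` must act as `u i` does, and the complement through the torus at
  -- position 0. The two images commute by `hcomm'`.
  let f : ∀ i, Z i →* (RepModule n (Σ i, Fin (l i + 1)) C ≃ₗ[ℤ] RepModule n _ C) := fun i =>
    (MonoidHom.noncommCoprod (zpowersHom _ (f₀ (u i)))
      ((MulAut.conj (f₀ (c i))).toMonoidHom.comp (torusAut D ⟨i, 0⟩))
      (fun k a => by
        rw [zpowersHom_apply]
        exact (hcomm' i a).zpow_left _)).comp ((ev i).prod (E i))
  have hf : ∀ i z, f i z = f₀ (u i) ^ (ev i z).toAdd *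
      (f₀ (c i) * torusAut D ⟨i, 0⟩ (E i z) * (f₀ (c i))⁻¹) := by
    intro i z
    simp [f]
  obtain ⟨Φ, hΦ₀, hΦ⟩ := hlift _ f₀ f fun i => by rw [hf, hev, hE]; simp
  refine IsZLinear.of_injective Φ (injective_of_partial_action (τ := τ) (D := D) c₀ hgen' hrel hP Φ
    (fun s => by simp [hΦ₀, f₀]) ?_)
  rintro ⟨i, κ⟩ _ ⟨z, rfl⟩
  have h1 := eq_conj_partialProd _ (fun κ => torusAut D ⟨i, κ⟩ (E i z)) (fun κ => hrel' i κ _) κ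
  -- `S` followed by `E` is the identity only on the range of `E`; this is why faithfulness is
  -- stated relative to the subgroups `P j`.
  have hevS : ev i (S i (E i z)) = 1 := by
    rw [hS, map_mul, map_inv, map_zpow, hev, ← ofAdd_zsmul]
    simp
  have hES : E i (S i (E i z)) = E i z := by
    rw [hS, map_mul, map_inv, map_zpow, hE]
    simp
  rw [hb, map_mul, map_mul, map_mul, map_mul, map_inv, map_inv, hΦ₀, hΦ₀, hΦ, hf, hevS, hES, h1,
    ← map_partialProd]
  simp only [p, toAdd_one, zpow_zero]
  group

end Star

/-! ### The fundamental group of a graph of groups -/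

namespace GraphOfGroups

variable {V : Type u} {E : Type v} {Γ : SerreGraph V E} (𝒢 : GraphOfGroups.{u, v, w, x} Γ)
  (T : Set E)

/-- The homomorphism of a vertex group into the fundamental group. -/
def ofVertex (p : V) : 𝒢.vertexGroup p →* 𝒢.FundamentalGroup T :=
  (QuotientGroup.mk' _).comp ((QuotientGroup.mk' _).comp
    ((Monoid.Coprod.inl : _ →* 𝒢.FreeProd).comp Monoid.CoprodI.of))

/-- The element of the fundamental group given by an oriented edge. -/
def ofEdge (e : E) (b : Bool) : 𝒢.FundamentalGroup T :=
  QuotientGroup.mk (QuotientGroup.mk (𝒢.letter e b) : 𝒢.PathGroup)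

variable {T}

theorem ofEdge_eq_one {e : E} (he : e ∈ T) (b : Bool) : 𝒢.ofEdge T e b = 1 :=
  (QuotientGroup.eq_one_iff _).2 (Subgroup.subset_normalClosure ⟨e, he, b, rfl⟩)

variable (T)

theorem ofEdge_conj (e : E) (b : Bool) (g : 𝒢.edgeGroup e) :
    𝒢.ofEdge T e b * 𝒢.ofVertex T _ (𝒢.incl e b g) * (𝒢.ofEdge T e b)⁻¹ =
      𝒢.ofVertex T _ (𝒢.incl e (!b) g) := by
  rw [← mul_inv_eq_one]
  have : (QuotientGroup.mk (𝒢.letter e b * 𝒢.vert _ (𝒢.incl e b g) * (𝒢.letter e b)⁻¹ *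
      (𝒢.vert _ (𝒢.incl e (!b) g))⁻¹) : 𝒢.PathGroup) = 1 :=
    (QuotientGroup.eq_one_iff _).2 (Subgroup.subset_normalClosure (.inl ⟨e, b, g, rfl⟩))
  exact congrArg (QuotientGroup.mk' _) this

variable {T}

theorem ofVertex_incl {e : E} (he : e ∈ T) (b : Bool) (g : 𝒢.edgeGroup e) :
    𝒢.ofVertex T _ (𝒢.incl e b g) = 𝒢.ofVertex T _ (𝒢.incl e (!b) g) := by
  have := 𝒢.ofEdge_conj T e b g
  rwa [𝒢.ofEdge_eq_one he, one_mul, inv_one, mul_one] at this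

theorem eq_top_of_ofVertex_mem (hT : ∀ e, e ∈ T) (K : Subgroup (𝒢.FundamentalGroup T))
    (hK : ∀ p g, 𝒢.ofVertex T p g ∈ K) : K = ⊤ := by
  let π : 𝒢.FreeProd →* 𝒢.FundamentalGroup T :=
    (QuotientGroup.mk' _).comp (QuotientGroup.mk' _)
  have hπ : ∀ y, π y ∈ K := by
    intro y
    induction y using Monoid.Coprod.induction_on with
    | inl y =>
      induction y using Monoid.CoprodI.induction_on with
      | one => rw [map_one, map_one]; exact one_mem K
      | of p g => exact hK p g
      | mul y y' h h' => rw [map_mul, map_mul]; exact mul_mem h h'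
    | inr y =>
      have : π.comp Monoid.Coprod.inr = 1 :=
        FreeGroup.ext_hom _ _ fun d => 𝒢.ofEdge_eq_one (hT d.1) d.2
      rw [← MonoidHom.comp_apply, this]
      exact one_mem K
    | mul y y' h h' => rw [map_mul]; exact mul_mem h h'
  refine (Subgroup.eq_top_iff' K).2 fun g => ?_
  obtain ⟨g', rfl⟩ := QuotientGroup.mk_surjective g
  obtain ⟨y, rfl⟩ := QuotientGroup.mk_surjective g'
  exact hπ y

theorem exists_lift {H : Type*} [Group H] (f : ∀ p, 𝒢.vertexGroup p →* H)
    (hf : ∀ e b g, f _ (𝒢.incl e b g) = f _ (𝒢.incl e (!b) g)) :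
    ∃ Φ : 𝒢.FundamentalGroup T →* H, ∀ p g, Φ (𝒢.ofVertex T p g) = f p g := by
  let Ψ : 𝒢.FreeProd →* H := Monoid.Coprod.lift (Monoid.CoprodI.lift f) 1
  have hv : ∀ p g, Ψ (𝒢.vert p g) = f p g := fun p g => by simp [Ψ, vert]
  have hl : ∀ e b, Ψ (𝒢.letter e b) = 1 := fun e b => by simp [Ψ, letter]
  have hΨ : Subgroup.normalClosure 𝒢.pathRelators ≤ Ψ.ker := by
    refine Subgroup.normalClosure_le_normal ?_
    rintro _ (⟨e, b, g, rfl⟩ | ⟨e, b, rfl⟩)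
    · simp [MonoidHom.mem_ker, hv, hl, hf e b g]
    · simp [MonoidHom.mem_ker, hl]
  refine ⟨QuotientGroup.lift _ (QuotientGroup.lift _ Ψ hΨ) ?_, hv⟩
  refine Subgroup.normalClosure_le_normal (N := (QuotientGroup.lift _ Ψ hΨ).ker) ?_
  rintro _ ⟨e, -, b, rfl⟩
  exact hl e b

end GraphOfGroups

/-- Without its only edge pair, an external vertex cannot be reached from the centre. -/
theorem SerreGraph.IsMaximalSubtree.mem_of_starGraph {m : ℕ} {T : Set (Fin m)}
    (hT : (SerreGraph.starGraph m).IsMaximalSubtree T) (i : Fin m) : i ∈ T := by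
  by_contra hi
  have key : ∀ (l : List (Fin m × Bool)) (p q : Option (Fin m)), p ≠ some i →
      (SerreGraph.starGraph m).IsPath p l q → (∀ d ∈ l, d.1 ∈ T) → q ≠ some i := by
    intro l
    induction l with
    | nil => rintro p q hp rfl -; exact hp
    | cons d l ih =>
      rintro p q hp ⟨-, h⟩ hd
      refine ih _ q ?_ h fun d' hd' => hd d' (List.mem_cons_of_mem _ hd')
      have hdi : d.1 ≠ i := fun h => hi (h ▸ hd d List.mem_cons_self)
      rcases d with ⟨e, _ | _⟩
      · exact fun h => hdi (Option.some.inj h)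
      · exact fun h => nomatch h
  obtain ⟨l, hl, hlT⟩ := hT.1 none (some i)
  exact key l _ _ (by simp) hl hlT rfl

theorem mainTheorem2 (m : ℕ)
    (𝒢 : GraphOfGroups.{0, 0, w, x} (SerreGraph.starGraph m))
    (hcentral : IsFreeOfFiniteRank (𝒢.vertexGroup none))
    (hleaf : ∀ i : Fin m, IsFreeAbelianOfFiniteRank (𝒢.vertexGroup (some i)))
    (k : ∀ i : Fin m, 𝒢.edgeGroup i)
    (hk : ∀ (i : Fin m) (g : 𝒢.edgeGroup i), g ∈ Subgroup.zpowers (k i))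
    (hprim : ∀ i : Fin m, IsPrimitiveElement (𝒢.incl i true (k i)))
    (T : Set (Fin m)) (hT : (SerreGraph.starGraph m).IsMaximalSubtree T) :
    IsZLinear (𝒢.FundamentalGroup T) := by
  obtain ⟨n, ⟨ψ⟩⟩ := hcentral
  let α : ∀ i : Fin m, 𝒢.edgeGroup i →* 𝒢.vertexGroup none := fun i => 𝒢.incl i false
  let ω : ∀ i : Fin m, 𝒢.edgeGroup i →* 𝒢.vertexGroup (some i) := fun i => 𝒢.incl i true
  have hmem := hT.mem_of_starGraph
  refine isZLinear_of_star (Z := fun i => 𝒢.vertexGroup (some i)) (w := fun i => ω i (k i)) hprim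
    (u := fun i => ψ (α i (k i))) (fun i h => ?_)
    (ν₀ := (𝒢.ofVertex T none).comp ψ.symm.toMonoidHom) (ν := fun i => 𝒢.ofVertex T (some i))
    (fun i => ?_) (fun K h₀ h => ?_) fun H _ f₀ f hf => ?_
  -- If `u i` were trivial, injectivity would give `k i = 1`, but a primitive element has a
  -- coordinate equal to 1.
  · have hki : k i = 1 := 𝒢.incl_injective i false
      (ψ.injective (h.trans (by rw [map_one, map_one]) : ψ (α i (k i)) = ψ (α i 1)))
    obtain ⟨r, φ, j, hφ⟩ := hprim i
    rw [hki, map_one, map_one] at hφ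
    have := congrFun (congrArg Multiplicative.toAdd hφ) j
    simp at this
  · change 𝒢.ofVertex T none (ψ.symm (ψ (α i (k i)))) = _
    rw [ψ.symm_apply_apply]
    exact 𝒢.ofVertex_incl (hmem i) false (k i)
  · refine 𝒢.eq_top_of_ofVertex_mem hmem K ?_
    rintro (_ | i) g
    · simpa using h₀ (ψ g)
    · exact h i g
  · let F : ∀ p, 𝒢.vertexGroup p →* H := fun p =>
      match p with
      | none => f₀.comp ψ.toMonoidHom
      | some i => f i
    -- The edge group is cyclic, so agreement on its generator suffices.
    have hF : ∀ i (g : 𝒢.edgeGroup i), F none (α i g) = F (some i) (ω i g) := by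
      intro i g
      obtain ⟨z, rfl⟩ := hk i g
      have h1 : F none (α i (k i)) = F (some i) (ω i (k i)) := hf i
      simp only [map_zpow, h1]
    obtain ⟨Φ, hΦ⟩ := 𝒢.exists_lift (T := T) F (by
      rintro i (_ | _) g
      · exact hF i g
      · exact (hF i g).symm)
    exact ⟨Φ, fun y => by simp [hΦ, F], fun i z => hΦ (some i) z⟩
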